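/- Let $m,n_1,n_2\ge 1$ be fixed integers. For a finite field $\mathbb F$, put $t=1/|\mathbb F|$. A matrix $Q=(q_{ij})\in\mathbb F[z]^{m\times m}$ is in Hermite form if it is lower triangular, its diagonal entries are monic, and $\deg q_{ij}<\deg q_{ii}$ for $j<i$ (where $\deg 0=-\infty$). Let $X(n_1,n_2)$ be the finite set of pairs $(D_1,D_2)$ of matrices in $\mathbb F[z]^{m\times m}$ in Hermite form with $\deg\det D_i=n_i$ for $i=1,2$, endowed with the uniform distribution. Call $D_1,D_2$ left coprime if they have a greatest common left divisor $H$ that is right invertible, i.e. $HX=I_m$ for some polynomial matrix $X$. (A common left divisor is a polynomial matrix $H$ with $m$ rows and any number of columns such that $D_i=HX_i$ for polynomial matrices $X_i$, $i=1,2$; it is greatest if for every common left divisor $\tilde H$ one has $H=\tilde H S$ for some polynomial matrix $S$.) Then the probability that $D_1,D_2$ are left coprime is $$1-t^m+O(t^{m+1})\qquad\text{as } |\mathbb F|\to\infty;$$ that is, there is a constant $C$, depending only on $m,n_1,n_2$, such that for every finite field $\mathbb F$ this probability differs from $1-t^m$ by at most $C\,t^{m+1}$. -/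

import Mathlib

open Polynomial

namespace PolyMat

/-- `H` is a common left divisor of the matrices `A i`: each `A i` equals `H * X i` for some
matrix `X i`. -/
def IsCommonLeftDivisor {R : Type*} [CommRing R] {ι : Type*} {p k : ℕ} {c : ι → ℕ}
    (A : ∀ i, Matrix (Fin p) (Fin (c i)) R) (H : Matrix (Fin p) (Fin k) R) : Prop :=
  ∀ i, ∃ X : Matrix (Fin k) (Fin (c i)) R, A i = H * X

/-- `H` is a greatest common left divisor of the matrices `A i`: it is a common left divisor, and
every common left divisor `H'` (with any number of columns) is a left divisor of `H`. -/
def IsGCLD {R : Type*} [CommRing R] {ι : Type*} {p k : ℕ} {c : ι → ℕ}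
    (A : ∀ i, Matrix (Fin p) (Fin (c i)) R) (H : Matrix (Fin p) (Fin k) R) : Prop :=
  IsCommonLeftDivisor A H ∧
    ∀ (k' : ℕ) (H' : Matrix (Fin p) (Fin k') R), IsCommonLeftDivisor A H' →
      ∃ S : Matrix (Fin k') (Fin k) R, H = H' * S

/-- The matrices `A i` are left coprime: they have a greatest common left divisor that has a
right inverse. -/
def LeftCoprime {R : Type*} [CommRing R] {ι : Type*} {p : ℕ} {c : ι → ℕ}
    (A : ∀ i, Matrix (Fin p) (Fin (c i)) R) : Prop :=
  ∃ (k : ℕ) (H : Matrix (Fin p) (Fin k) R), IsGCLD A H ∧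
    ∃ X : Matrix (Fin k) (Fin p) R, H * X = 1

/-- Hermite canonical form: lower triangular, monic diagonal entries, and every entry to the left
of the diagonal has degree strictly below that of the diagonal entry in its row
(with `degree 0 = ⊥`, so it vanishes when the diagonal entry is constant). -/
structure IsHermiteForm {F : Type*} [Field F] {m : ℕ} (Q : Matrix (Fin m) (Fin m) F[X]) :
    Prop where
  upper_eq_zero : ∀ i j, i < j → Q i j = 0
  diag_monic : ∀ i, (Q i i).Monic
  degree_lt : ∀ i j, j < i → (Q i j).degree < (Q i i).degree

/-- The set of all `N`-tuples of `m × m` polynomial matrices in Hermite form whose determinants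
have the prescribed degrees. -/
def hermiteTuples (F : Type*) [Field F] (m : ℕ) {N : ℕ} (n : Fin N → ℕ) :
    Set (Fin N → Matrix (Fin m) (Fin m) F[X]) :=
  {D | ∀ i, IsHermiteForm (D i) ∧ (D i).det.natDegree = n i}

theorem IsHermiteForm.det_natDegree {F : Type*} [Field F] {m : ℕ}
    {Q : Matrix (Fin m) (Fin m) F[X]} (h : IsHermiteForm Q) :
    Q.det.natDegree = ∑ i, (Q i i).natDegree := by
  rw [Matrix.det_of_isLowerTriangular Q (fun i j hij => h.upper_eq_zero i j hij)]
  exact natDegree_prod_of_monic _ _ fun i _ => h.diag_monic i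

/-- Over a finite field there are only finitely many such tuples, so that the uniform distribution
on them makes sense. -/
theorem hermiteTuples_finite (F : Type*) [Field F] [Finite F] (m : ℕ) {N : ℕ} (n : Fin N → ℕ) :
    (hermiteTuples F m n).Finite := by
  have hfin : ∀ d : ℕ, {f : F[X] | f.degree < (d : WithBot ℕ)}.Finite := fun d => by
    have e := (degreeLTEquiv F d).toEquiv
    have : Finite (degreeLT F d) := Finite.of_equiv _ e.symm
    refine Set.Finite.subset (Set.toFinite (degreeLT F d : Set F[X])) fun f hf => ?_
    exact mem_degreeLT.2 hf
  have key : ∀ d : ℕ, {Q : Matrix (Fin m) (Fin m) F[X] |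
      IsHermiteForm Q ∧ Q.det.natDegree = d}.Finite := fun d => by
    refine Set.Finite.subset
      (Set.Finite.pi' fun _ : Fin m => Set.Finite.pi' fun _ : Fin m => hfin (d + 1)) ?_
    rintro Q ⟨hQ, hd⟩ i j
    have hi : (Q i i).degree < ((d + 1 : ℕ) : WithBot ℕ) := by
      refine lt_of_le_of_lt degree_le_natDegree ?_
      rw [hQ.det_natDegree] at hd
      have := Finset.single_le_sum (f := fun i => (Q i i).natDegree)
        (fun _ _ => Nat.zero_le _) (Finset.mem_univ i)
      exact_mod_cast (by omega : (Q i i).natDegree < d + 1)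
    rcases lt_trichotomy i j with hij | rfl | hij
    · show (Q i j).degree < _
      rw [hQ.upper_eq_zero i j hij, degree_zero]
      exact WithBot.bot_lt_coe _
    · exact hi
    · exact (hQ.degree_lt i j hij).trans hi
  exact Set.Finite.subset (Set.Finite.pi' fun i => key (n i)) fun D hD i => hD i

/-- The probability, for the uniform distribution on `hermiteTuples F m n`, that the matrices of
the tuple are left coprime. -/
noncomputable def probLeftCoprime (F : Type*) [Field F] (m : ℕ) {N : ℕ} (n : Fin N → ℕ) : ℝ :=
  ({D ∈ hermiteTuples F m n | LeftCoprime D}.ncard : ℝ) / ((hermiteTuples F m n).ncard : ℝ)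

end PolyMat

/-! Hermite forms with determinant of degree `n` are normal forms for full-rank submodules of
`F[X]^m` (lattices) of degree `n`, via the column module (`bijOn_colModule`), and coprimality means
that two lattices sum to the whole space (`leftCoprime_iff_of_det_ne_zero`).

Sort all pairs of lattices by their sum `M`. If `M` has degree `k`, dividing by a matrix with column
module `M` turns pairs with sum `M` into coprime pairs of degrees `n₁ - k`, `n₂ - k`. With `A`
counting lattices and `P` coprime pairs, `A n₁ * A n₂ = ∑ k, A k * P (n₁ - k) (n₂ - k)`
(`ncard_mul_ncard_eq_sum`).

Counting free coefficients gives `A n = |F|^(mn) (1 + O(t))` (`ncard_latticesOfDegree_bounds`).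
After normalisation the `k`-th term of the recursion carries a factor `t^(mk)`, so the `k = 1` term
is `t^m (1 + O(t))` and the later ones are `O(t^(2m))`, which is within `O(t^(m+1))`. -/

namespace PolyMat

variable {F : Type*} [Field F] {m : ℕ}

/-! ### Column modules and Hermite normal form. -/

/-- The column module of a square matrix. -/
abbrev colModule {R : Type*} [CommRing R] {p k : ℕ} (D : Matrix (Fin p) (Fin k) R) :
    Submodule R (Fin p → R) :=
  LinearMap.range D.mulVecLin

theorem colModule_le_iff {R : Type*} [CommRing R] {p k l : ℕ} {D : Matrix (Fin p) (Fin k) R}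
    {H : Matrix (Fin p) (Fin l) R} :
    colModule D ≤ colModule H ↔ ∃ X : Matrix (Fin l) (Fin k) R, D = H * X := by
  constructor
  · intro h
    have : ∀ j, ∃ x, H.mulVec x = D.col j := fun j => by
      have := h ⟨Pi.single j 1, rfl⟩
      obtain ⟨x, hx⟩ := this
      exact ⟨x, by simpa using hx⟩
    choose x hx using this
    refine ⟨Matrix.of fun i j => x j i, ?_⟩
    ext i j
    have := congrFun (hx j) i
    simpa [Matrix.mul_apply, Matrix.mulVec, dotProduct] using this.symm
  · rintro ⟨X, rfl⟩ _ ⟨v, rfl⟩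
    exact ⟨X.mulVec v, by simp⟩

theorem col_mem_colModule {R : Type*} [CommRing R] {p k : ℕ} (Q : Matrix (Fin p) (Fin k) R)
    (j : Fin k) :
    (fun i => Q i j) ∈ colModule Q :=
  ⟨Pi.single j 1, by ext i; simp⟩

theorem colModule_one {R : Type*} [CommRing R] {p : ℕ} :
    colModule (1 : Matrix (Fin p) (Fin p) R) = ⊤ := by
  simp [colModule]

theorem colModule_mul {R : Type*} [CommRing R] {p k l : ℕ} (H : Matrix (Fin p) (Fin l) R)
    (X : Matrix (Fin l) (Fin k) R) :
    colModule (H * X) = (colModule X).map H.mulVecLin := by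
  rw [colModule, Matrix.mulVecLin_mul, LinearMap.range_comp]

theorem IsHermiteForm.det_monic {Q : Matrix (Fin m) (Fin m) F[X]} (h : IsHermiteForm Q) :
    Q.det.Monic := by
  rw [Matrix.det_of_isLowerTriangular Q (fun i j hij => h.upper_eq_zero i j hij)]
  exact monic_prod_of_monic _ _ fun i _ => h.diag_monic i

/-- Over a principal ideal domain, the leading entries of a submodule are generated by one of
them. -/
theorem exists_monic_leading {M : Submodule F[X] (Fin m → F[X])} {D : Matrix (Fin m) (Fin m) F[X]}
    (hD : D.det ≠ 0) (hDM : colModule D ≤ M) (i : Fin m) :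
    ∃ v ∈ M, (∀ j < i, v j = 0) ∧ (v i).Monic ∧
      ∀ w ∈ M, (∀ j < i, w j = 0) → v i ∣ w i := by
  let N : Submodule F[X] (Fin m → F[X]) := M ⊓ ⨅ j : {j // j < i}, LinearMap.ker (LinearMap.proj j.1)
  have hN : ∀ w, w ∈ N ↔ w ∈ M ∧ ∀ j < i, w j = 0 := fun w => by
    simp [N]
  let I : Ideal F[X] := N.map (LinearMap.proj i)
  obtain ⟨g, hg⟩ := (IsPrincipalIdealRing.principal I).principal
  have hgI : ∀ x, x ∈ I ↔ g ∣ x := fun x => by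
    rw [hg]; exact Ideal.mem_span_singleton
  -- `D * adjugate D = det D • 1` puts `det D • e_i` in `M`, so the ideal of leading entries is
  -- nonzero.
  have hdet : D.det ∈ I := by
    refine ⟨D.det • Pi.single i 1, (hN _).2 ⟨hDM ⟨D.adjugate.mulVec (Pi.single i 1), ?_⟩, ?_⟩, by simp⟩
    · rw [Matrix.mulVecLin_apply, Matrix.mulVec_mulVec, Matrix.mul_adjugate, Matrix.smul_mulVec,
        Matrix.one_mulVec]
    · intro j hj
      simp [Pi.single_eq_of_ne hj.ne]
  have hg0 : g ≠ 0 := by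
    rintro rfl
    exact hD (zero_dvd_iff.1 ((hgI _).1 hdet))
  obtain ⟨v, hv, hvi⟩ : g * C g.leadingCoeff⁻¹ ∈ I := (hgI _).2 (dvd_mul_right _ _)
  obtain ⟨hvM, hv0⟩ := (hN v).1 hv
  have hvi : v i = g * C g.leadingCoeff⁻¹ := hvi
  refine ⟨v, hvM, hv0, hvi ▸ monic_mul_leadingCoeff_inv hg0, fun w hw hw0 => ?_⟩
  rw [hvi]
  refine (IsUnit.mul_right_dvd ?_).2 ((hgI _).1 ⟨w, (hN w).2 ⟨hw, hw0⟩, rfl⟩)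
  exact isUnit_C.2 (isUnit_iff_ne_zero.2 (inv_ne_zero (leadingCoeff_ne_zero.2 hg0)))

/-- Monic generators of the leading-entry ideals supply the diagonal; division with remainder by
later columns then shrinks the entries below it. -/
theorem exists_isHermiteForm {M : Submodule F[X] (Fin m → F[X])}
    {D : Matrix (Fin m) (Fin m) F[X]} (hD : D.det ≠ 0) (hDM : colModule D ≤ M) :
    ∃ Q : Matrix (Fin m) (Fin m) F[X], IsHermiteForm Q ∧ colModule Q = M := by
  choose v hvM hv0 hvmon hvdvd using exists_monic_leading hD hDM
  -- Entries are reduced in order of increasing row: subtracting a multiple of `v l` leaves the rows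
  -- before `l` unchanged.
  have red : ∀ (i : Fin m) (k : ℕ), ∃ r ∈ M, (∀ j < i, r j = 0) ∧ r i = v i i ∧
      ∀ j, i < j → (j : ℕ) < k → (r j).degree < (v j j).degree := by
    intro i k
    induction k with
    | zero => exact ⟨v i, hvM i, hv0 i, rfl, fun j _ h => absurd h (Nat.not_lt_zero _)⟩
    | succ k ih =>
      obtain ⟨r, hrM, hr0, hri, hr⟩ := ih
      by_cases hk : ∃ l : Fin m, i < l ∧ (l : ℕ) = k
      · obtain ⟨l, hil, rfl⟩ := hk
        refine ⟨r - (r l /ₘ v l l) • v l, M.sub_mem hrM (M.smul_mem _ (hvM l)), ?_, ?_, ?_⟩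
        · intro j hj
          simp [hr0 j hj, hv0 l j (hj.trans hil)]
        · simp [hri, hv0 l i hil]
        · intro j hij hjl
          rcases (Nat.lt_succ_iff.1 hjl).lt_or_eq with h | h
          · simpa [hv0 l j h] using hr j hij h
          · obtain rfl := Fin.ext h
            have : (r - (r j /ₘ v j j) • v j) j = r j %ₘ v j j := by
              rw [modByMonic_eq_sub_mul_div]
              simp [mul_comm]
            rw [this]
            exact degree_modByMonic_lt _ (hvmon j)
      · refine ⟨r, hrM, hr0, hri, fun j hij hj => hr j hij ?_⟩
        rcases (Nat.lt_succ_iff.1 hj).lt_or_eq with h | h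
        · exact h
        · exact absurd ⟨j, hij, h⟩ hk
  choose r hrM hr0 hrd hrlt using fun i => red i m
  let Q : Matrix (Fin m) (Fin m) F[X] := Matrix.of fun i j => r j i
  have hQcol : ∀ j, Q.mulVec (Pi.single j 1) = r j := fun j => by
    ext i; simp [Q]
  refine ⟨Q, ⟨fun i j hij => hr0 j i hij, fun i => ?_, fun i j hij => ?_⟩, le_antisymm ?_ ?_⟩
  · simpa [Q, hrd] using hvmon i
  · simpa [Q, hrd] using hrlt j i hij i.2
  · rintro _ ⟨x, rfl⟩
    have : Q.mulVecLin x = ∑ j, x j • r j := by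
      ext1 i
      simp [Q, Matrix.mulVec, dotProduct, mul_comm]
    rw [this]
    exact M.sum_mem fun j _ => M.smul_mem _ (hrM j)
  -- Elimination from the top: a multiple of column `k` cancels the leading entry of `w`, and `l`
  -- counts the rows still to clear.
  · have key : ∀ l k : ℕ, k + l = m → ∀ w ∈ M, (∀ j : Fin m, (j : ℕ) < k → w j = 0) →
        w ∈ colModule Q := by
      intro l
      induction l with
      | zero =>
        intro k hk w _ hw0
        have : w = 0 := funext fun j => hw0 j (by omega)
        rw [this]
        exact Submodule.zero_mem _
      | succ l ih =>
        intro k hk w hw hw0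
        obtain ⟨c, hc⟩ := hvdvd ⟨k, by omega⟩ w hw fun j hj => hw0 j hj
        set K : Fin m := ⟨k, by omega⟩ with hK
        have h1 : w - c • r K ∈ colModule Q := by
          refine ih (k + 1) (by omega) _ (M.sub_mem hw (M.smul_mem _ (hrM K))) fun j hj => ?_
          rcases (Nat.lt_succ_iff.1 hj).lt_or_eq with h | h
          · simp [hw0 j h, hr0 K j h]
          · obtain rfl : j = K := Fin.ext h
            simp [hc, hrd, mul_comm]
        have h2 : c • r K ∈ colModule Q := Submodule.smul_mem _ _ ⟨Pi.single K 1, hQcol K⟩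
        simpa using Submodule.add_mem _ h1 h2
    intro w hw
    exact key m 0 (zero_add m) w hw fun j hj => absurd hj (Nat.not_lt_zero _)

/-- Forward substitution in `w = Q x`: the coordinates of `x` before `i` vanish, leaving `w i = Q i
i * x i`. -/
theorem IsHermiteForm.diag_dvd {Q : Matrix (Fin m) (Fin m) F[X]} (h : IsHermiteForm Q)
    {w : Fin m → F[X]} (hw : w ∈ colModule Q) {i : Fin m} (hw0 : ∀ j < i, w j = 0) :
    Q i i ∣ w i := by
  obtain ⟨x, rfl⟩ := hw
  have hx : ∀ k : Fin m, (∀ j < k, x j = 0) → Q.mulVecLin x k = Q k k * x k := fun k hk => by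
    rw [Matrix.mulVecLin_apply, Matrix.mulVec, dotProduct, Finset.sum_eq_single k]
    · intro j _ hj
      rcases hj.lt_or_gt with hj | hj
      · simp [hk j hj]
      · simp [h.upper_eq_zero k j hj]
    · simp
  have hx0 : ∀ k < i, x k = 0 := by
    intro k
    induction k using WellFoundedLT.induction with
    | ind k ih =>
      intro hk
      have h1 := hx k fun j hj => ih j hj (hj.trans hk)
      rw [hw0 k hk] at h1
      exact (mul_eq_zero.1 h1.symm).resolve_left (h.diag_monic k).ne_zero
  exact ⟨x i, hx i hx0⟩

/-- Diagonal entries are monic and divide each other. Below the diagonal, by induction on the row,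
`Q i i` divides a difference of smaller degree. -/
theorem IsHermiteForm.eq_of_colModule_eq {Q Q' : Matrix (Fin m) (Fin m) F[X]}
    (h : IsHermiteForm Q) (h' : IsHermiteForm Q') (e : colModule Q = colModule Q') : Q = Q' := by
  have hd : ∀ i, Q i i = Q' i i := fun i =>
    eq_of_monic_of_associated (h.diag_monic i) (h'.diag_monic i) <| associated_of_dvd_dvd
      (h.diag_dvd (w := fun k => Q' k i) (e ▸ col_mem_colModule Q' i) fun j hj => h'.upper_eq_zero j i hj)
      (h'.diag_dvd (w := fun k => Q k i) (e ▸ col_mem_colModule Q i) fun j hj => h.upper_eq_zero j i hj)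
  ext1 i j
  induction i using WellFoundedLT.induction with
  | ind i ih =>
    rcases lt_trichotomy i j with hij | rfl | hij
    · rw [h.upper_eq_zero i j hij, h'.upper_eq_zero i j hij]
    · exact hd i
    · have hmem : (fun i => Q i j) - (fun i => Q' i j) ∈ colModule Q :=
        Submodule.sub_mem _ (col_mem_colModule Q j) (e ▸ col_mem_colModule Q' j)
      have hdvd := h.diag_dvd hmem (i := i) fun k hk => by simp [ih k hk]
      refine sub_eq_zero.1 (eq_zero_of_dvd_of_degree_lt hdvd ?_)
      refine lt_of_le_of_lt (degree_sub_le _ _) (max_lt (h.degree_lt i j hij) ?_)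
      rw [hd]
      exact h'.degree_lt i j hij

/-! ### Coprimality in terms of lattices. -/

theorem leftCoprime_iff_of_det_ne_zero (D : Fin 2 → Matrix (Fin m) (Fin m) F[X])
    (hD : (D 0).det ≠ 0) :
    LeftCoprime D ↔ colModule (D 0) ⊔ colModule (D 1) = ⊤ := by
  constructor
  · rintro ⟨k, H, ⟨-, hH⟩, X, hX⟩
    -- The sum of the column modules is itself a column module, so its generator `Q` is a common
    -- left divisor and `H` factors through it.
    obtain ⟨Q, -, hQ⟩ := exists_isHermiteForm hD
      (le_sup_left : _ ≤ colModule (D 0) ⊔ colModule (D 1))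
    obtain ⟨S, rfl⟩ := hH m Q fun i => colModule_le_iff.1 <| by
      rw [hQ]
      fin_cases i
      · exact le_sup_left
      · exact le_sup_right
    rw [← hQ, eq_top_iff, ← colModule_one]
    exact colModule_le_iff.2 ⟨S * X, by rw [← hX, Matrix.mul_assoc]⟩
  · intro h
    refine ⟨m, 1, ⟨fun i => ⟨D i, (Matrix.one_mul _).symm⟩, fun k' H' hH' => ?_⟩, 1,
      Matrix.one_mul _⟩
    refine colModule_le_iff.1 ?_
    rw [colModule_one, ← h]
    exact sup_le (colModule_le_iff.2 (hH' 0)) (colModule_le_iff.2 (hH' 1))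

/-- The submodules of `F[X]^m` spanned by the columns of a square matrix whose determinant is
nonzero of degree `n`. -/
def latticesOfDegree (F : Type*) [Field F] (m n : ℕ) : Set (Submodule F[X] (Fin m → F[X])) :=
  {M | ∃ D : Matrix (Fin m) (Fin m) F[X], D.det ≠ 0 ∧ D.det.natDegree = n ∧ colModule D = M}

/-- Matrices with equal column modules divide each other, hence so do their determinants: the degree
belongs to the lattice. -/
theorem det_of_colModule_mem {D : Matrix (Fin m) (Fin m) F[X]} {n : ℕ}
    (h : colModule D ∈ latticesOfDegree F m n) : D.det ≠ 0 ∧ D.det.natDegree = n := by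
  obtain ⟨D', h0, hn, e⟩ := h
  obtain ⟨X, hX⟩ := colModule_le_iff.1 e.le
  obtain ⟨Y, hY⟩ := colModule_le_iff.1 e.ge
  have h1 : D'.det = D.det * X.det := by rw [hX, Matrix.det_mul]
  have h2 : D.det = D'.det * Y.det := by rw [hY, Matrix.det_mul]
  have hne : D.det ≠ 0 := fun h => h0 (by rw [h1, h, zero_mul])
  exact ⟨hne, hn ▸ le_antisymm (natDegree_le_of_dvd ⟨_, h1⟩ h0) (natDegree_le_of_dvd ⟨_, h2⟩ hne)⟩

theorem latticesOfDegree_unique {M : Submodule F[X] (Fin m → F[X])} {n k : ℕ}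
    (h : M ∈ latticesOfDegree F m n) (h' : M ∈ latticesOfDegree F m k) : n = k := by
  obtain ⟨D, -, hn, rfl⟩ := h
  exact hn.symm.trans (det_of_colModule_mem h').2

theorem exists_mem_latticesOfDegree_of_le {M N : Submodule F[X] (Fin m → F[X])} {n : ℕ}
    (h : M ∈ latticesOfDegree F m n) (hMN : M ≤ N) : ∃ k ≤ n, N ∈ latticesOfDegree F m k := by
  obtain ⟨D, h0, rfl, rfl⟩ := h
  obtain ⟨Q, hQ, rfl⟩ := exists_isHermiteForm h0 hMN
  obtain ⟨X, hX⟩ := colModule_le_iff.1 hMN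
  exact ⟨Q.det.natDegree, natDegree_le_of_dvd ⟨X.det, by rw [hX, Matrix.det_mul]⟩ h0, Q,
    hQ.det_monic.ne_zero, rfl, rfl⟩

theorem bijOn_colModule (n : ℕ) :
    Set.BijOn colModule {Q : Matrix (Fin m) (Fin m) F[X] | IsHermiteForm Q ∧ Q.det.natDegree = n}
      (latticesOfDegree F m n) := by
  refine ⟨fun Q hQ => ⟨Q, hQ.1.det_monic.ne_zero, hQ.2, rfl⟩,
    fun Q hQ Q' hQ' e => hQ.1.eq_of_colModule_eq hQ'.1 e, ?_⟩
  intro M hM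
  obtain ⟨D, h0, hn, rfl⟩ := id hM
  obtain ⟨Q, hQ, e⟩ := exists_isHermiteForm h0 le_rfl
  exact ⟨Q, ⟨hQ, (det_of_colModule_mem (e ▸ hM)).2⟩, e⟩

/-- Pairs of submodules of prescribed degrees with a given sum. -/
def latticePairs (F : Type*) [Field F] (m n₁ n₂ : ℕ) (M : Submodule F[X] (Fin m → F[X])) :
    Set (Submodule F[X] (Fin m → F[X]) × Submodule F[X] (Fin m → F[X])) :=
  {p ∈ latticesOfDegree F m n₁ ×ˢ latticesOfDegree F m n₂ | p.1 ⊔ p.2 = M}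

theorem bijOn_hermiteTuples (n₁ n₂ : ℕ) :
    Set.BijOn (fun D : Fin 2 → Matrix (Fin m) (Fin m) F[X] => (colModule (D 0), colModule (D 1)))
      (hermiteTuples F m ![n₁, n₂]) (latticesOfDegree F m n₁ ×ˢ latticesOfDegree F m n₂) := by
  have h₁ := bijOn_colModule (F := F) (m := m) n₁
  have h₂ := bijOn_colModule (F := F) (m := m) n₂
  refine ⟨fun D hD => ⟨h₁.mapsTo (hD 0), h₂.mapsTo (hD 1)⟩, fun D hD D' hD' e => ?_, ?_⟩
  · obtain ⟨e₁, e₂⟩ := Prod.mk.inj e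
    ext1 i
    fin_cases i
    · exact h₁.injOn (hD 0) (hD' 0) e₁
    · exact h₂.injOn (hD 1) (hD' 1) e₂
  · rintro ⟨M₁, M₂⟩ ⟨hM₁, hM₂⟩
    obtain ⟨D₁, hD₁, rfl⟩ := h₁.surjOn hM₁
    obtain ⟨D₂, hD₂, rfl⟩ := h₂.surjOn hM₂
    refine ⟨![D₁, D₂], fun i => ?_, rfl⟩
    fin_cases i
    · exact hD₁
    · exact hD₂

theorem ncard_hermiteTuples (n₁ n₂ : ℕ) :
    (hermiteTuples F m ![n₁, n₂]).ncard =
      (latticesOfDegree F m n₁).ncard * (latticesOfDegree F m n₂).ncard := by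
  rw [← Set.ncard_prod, ← (bijOn_hermiteTuples n₁ n₂).image_eq,
    (bijOn_hermiteTuples n₁ n₂).injOn.ncard_image]

theorem ncard_leftCoprime (n₁ n₂ : ℕ) :
    {D ∈ hermiteTuples F m ![n₁, n₂] | LeftCoprime D}.ncard =
      (latticePairs F m n₁ n₂ ⊤).ncard := by
  have h := bijOn_hermiteTuples (F := F) (m := m) n₁ n₂
  have hco : ∀ D ∈ hermiteTuples F m ![n₁, n₂],
      (LeftCoprime D ↔ colModule (D 0) ⊔ colModule (D 1) = ⊤) := fun D hD =>
    leftCoprime_iff_of_det_ne_zero D (hD 0).1.det_monic.ne_zero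
  rw [← (h.injOn.mono (Set.sep_subset _ _)).ncard_image]
  congr 1
  ext p
  constructor
  · rintro ⟨D, ⟨hD, hc⟩, rfl⟩
    exact ⟨h.mapsTo hD, (hco D hD).1 hc⟩
  · rintro ⟨hp, hs⟩
    obtain ⟨D, hD, rfl⟩ := h.surjOn hp
    exact ⟨D, ⟨hD, (hco D hD).2 hs⟩, rfl⟩

theorem latticesOfDegree_finite [Finite F] (n : ℕ) : (latticesOfDegree F m n).Finite := by
  have h := ((hermiteTuples_finite F m ![n, n]).image fun D => colModule (D 0))
  refine h.subset fun M hM => ?_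
  obtain ⟨D, hD, e⟩ := (bijOn_hermiteTuples n n).surjOn (Set.mk_mem_prod hM hM)
  exact ⟨D, hD, congrArg Prod.fst e⟩

/-! ### Sorting pairs of lattices by their sum. -/

theorem mulVecLin_injective {H : Matrix (Fin m) (Fin m) F[X]} (hH : H.det ≠ 0) :
    Function.Injective H.mulVecLin := by
  rw [← LinearMap.ker_eq_bot, Matrix.ker_mulVecLin_eq_bot_iff]
  intro v hv
  exact Matrix.eq_zero_of_mulVec_eq_zero hH hv

theorem map_mem_latticesOfDegree_iff {H : Matrix (Fin m) (Fin m) F[X]} (hH : H.det ≠ 0)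
    {M : Submodule F[X] (Fin m → F[X])} {n : ℕ} (hn : H.det.natDegree ≤ n) :
    M.map H.mulVecLin ∈ latticesOfDegree F m n ↔
      M ∈ latticesOfDegree F m (n - H.det.natDegree) := by
  constructor
  · intro h
    obtain ⟨D, h0, hd, e⟩ := id h
    obtain ⟨X, rfl⟩ := colModule_le_iff.1 (e.trans_le (LinearMap.map_le_range))
    rw [Matrix.det_mul] at h0 hd
    obtain ⟨-, hX⟩ := mul_ne_zero_iff.1 h0
    rw [natDegree_mul hH hX] at hd
    refine ⟨X, hX, by omega, ?_⟩
    rw [colModule_mul] at e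
    exact Submodule.map_injective_of_injective (mulVecLin_injective hH) e
  · rintro ⟨D, h0, hd, rfl⟩
    refine ⟨H * D, ?_, ?_, colModule_mul _ _⟩
    · rw [Matrix.det_mul]
      exact mul_ne_zero hH h0
    · rw [Matrix.det_mul, natDegree_mul hH h0]
      omega

/-- Multiplication by a matrix `H` with column module `M` is injective, carries the whole space onto
`M`, and raises degrees by `k`. -/
theorem ncard_latticePairs {M : Submodule F[X] (Fin m → F[X])} {k n₁ n₂ : ℕ}
    (hM : M ∈ latticesOfDegree F m k) (h₁ : k ≤ n₁) (h₂ : k ≤ n₂) :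
    (latticePairs F m n₁ n₂ M).ncard = (latticePairs F m (n₁ - k) (n₂ - k) ⊤).ncard := by
  obtain ⟨H, hH, rfl, rfl⟩ := hM
  have hinj := Submodule.map_injective_of_injective (mulVecLin_injective hH)
  refine .trans ?_ (Set.ncard_image_of_injective _ (hinj.prodMap hinj))
  congr 1
  ext ⟨M₁, M₂⟩
  constructor
  · rintro ⟨⟨hM₁, hM₂⟩, hs⟩
    have hs : M₁ ⊔ M₂ = colModule H := hs
    have e₁ := Submodule.map_comap_eq_of_le (le_sup_left.trans_eq hs)
    have e₂ := Submodule.map_comap_eq_of_le (le_sup_right.trans_eq hs)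
    refine ⟨(M₁.comap H.mulVecLin, M₂.comap H.mulVecLin), ⟨⟨?_, ?_⟩, hinj ?_⟩,
      Prod.ext e₁ e₂⟩
    · exact (map_mem_latticesOfDegree_iff hH h₁).1 (e₁.symm ▸ hM₁)
    · exact (map_mem_latticesOfDegree_iff hH h₂).1 (e₂.symm ▸ hM₂)
    · rw [Submodule.map_sup, Submodule.map_top]
      exact (congrArg₂ (· ⊔ ·) e₁ e₂).trans hs
  · rintro ⟨⟨N₁, N₂⟩, ⟨⟨hN₁, hN₂⟩, hs⟩, e⟩
    obtain ⟨rfl, rfl⟩ := Prod.mk.inj e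
    refine ⟨⟨(map_mem_latticesOfDegree_iff hH h₁).2 hN₁,
      (map_mem_latticesOfDegree_iff hH h₂).2 hN₂⟩, ?_⟩
    have hs : N₁ ⊔ N₂ = ⊤ := hs
    change N₁.map _ ⊔ N₂.map _ = _
    rw [← Submodule.map_sup, hs, Submodule.map_top]

theorem ncard_mul_ncard_eq_sum [Finite F] (n₁ n₂ : ℕ) :
    (latticesOfDegree F m n₁).ncard * (latticesOfDegree F m n₂).ncard =
      ∑ k ∈ Finset.range (min n₁ n₂ + 1),
        (latticesOfDegree F m k).ncard * (latticePairs F m (n₁ - k) (n₂ - k) ⊤).ncard := by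
  classical
  have hfin := fun n => latticesOfDegree_finite (F := F) (m := m) n
  let T := fun n => (hfin n).toFinset
  have hcard : ∀ n, (T n).card = (latticesOfDegree F m n).ncard := fun n =>
    (Set.ncard_eq_toFinset_card _ (hfin n)).symm
  have hmap : ∀ p ∈ T n₁ ×ˢ T n₂,
      p.1 ⊔ p.2 ∈ (Finset.range (min n₁ n₂ + 1)).biUnion T := by
    intro p hp
    simp only [T, Finset.mem_product, Set.Finite.mem_toFinset] at hp
    obtain ⟨k, hk, h⟩ := exists_mem_latticesOfDegree_of_le hp.1 le_sup_left
    obtain ⟨k', hk', h'⟩ := exists_mem_latticesOfDegree_of_le hp.2 le_sup_right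
    obtain rfl := latticesOfDegree_unique h h'
    simp only [T, Finset.mem_biUnion, Set.Finite.mem_toFinset, Finset.mem_range]
    exact ⟨k, by omega, h⟩
  rw [← hcard, ← hcard, ← Finset.card_product, Finset.card_eq_sum_card_fiberwise hmap,
    Finset.sum_biUnion]
  · refine Finset.sum_congr rfl fun k hk => ?_
    rw [Finset.mem_range] at hk
    rw [← hcard, ← smul_eq_mul]
    refine Finset.sum_eq_card_nsmul fun M hM => ?_
    rw [← ncard_latticePairs ((hfin k).mem_toFinset.1 hM) (by omega) (by omega),
      ← Set.ncard_coe_finset]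
    congr 1
    ext p
    simp [latticePairs, T]
  · intro k _ l _ hkl
    refine Finset.disjoint_left.2 fun M hM hM' => hkl ?_
    exact latticesOfDegree_unique ((hfin k).mem_toFinset.1 hM) ((hfin l).mem_toFinset.1 hM')

theorem ncard_latticePairs_le [Finite F] (n₁ n₂ : ℕ) (M : Submodule F[X] (Fin m → F[X])) :
    (latticePairs F m n₁ n₂ M).ncard ≤
      (latticesOfDegree F m n₁).ncard * (latticesOfDegree F m n₂).ncard := by
  rw [← Set.ncard_prod]
  exact Set.ncard_le_ncard (Set.sep_subset _ _)
    ((latticesOfDegree_finite n₁).prod (latticesOfDegree_finite n₂))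

/-! ### Counting Hermite forms. -/

theorem degree_X_pow_add_of_degree_lt {n : ℕ} {p : F[X]} (hp : p.degree < n) :
    (X ^ n + p).degree = (n : WithBot ℕ) := by
  rw [degree_add_eq_left_of_degree_lt (by rwa [degree_X_pow]), degree_X_pow]

/-- The matrix in Hermite form with diagonal degrees `d` and prescribed lower coefficients. -/
noncomputable def hermiteOfLower (d : Fin m → ℕ) (φ : ∀ i : Fin m, {j // j ≤ i} → degreeLT F (d i)) :
    Matrix (Fin m) (Fin m) F[X] :=
  Matrix.of fun i j => if h : j ≤ i then (if j = i then X ^ d i else 0) + (φ i ⟨j, h⟩ : F[X]) else 0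

theorem hermiteOfLower_injective (d : Fin m → ℕ) :
    Function.Injective (hermiteOfLower (F := F) d) := by
  intro φ ψ h
  ext1 i
  ext1 ⟨j, hj⟩
  have := congrFun (congrFun h i) j
  simpa [hermiteOfLower, hj] using this

theorem range_hermiteOfLower (d : Fin m → ℕ) :
    Set.range (hermiteOfLower (F := F) d) =
      {Q | IsHermiteForm Q ∧ ∀ i, (Q i i).natDegree = d i} := by
  ext Q
  constructor
  · rintro ⟨φ, rfl⟩
    have hlt : ∀ i j, (φ i j : F[X]).degree < d i := fun i j => mem_degreeLT.1 (φ i j).2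
    have hdiag : ∀ i, hermiteOfLower d φ i i = X ^ d i + (φ i ⟨i, le_rfl⟩ : F[X]) := fun i => by
      simp [hermiteOfLower]
    refine ⟨⟨fun i j hij => ?_, fun i => ?_, fun i j hij => ?_⟩, fun i => ?_⟩
    · simp [hermiteOfLower, hij.not_ge]
    · rw [hdiag]
      exact monic_X_pow_add (hlt _ _)
    · rw [hdiag, degree_X_pow_add_of_degree_lt (hlt _ _)]
      simpa [hermiteOfLower, hij.le, hij.ne] using hlt i _
    · rw [hdiag]
      exact natDegree_eq_of_degree_eq_some (degree_X_pow_add_of_degree_lt (hlt _ _))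
  · rintro ⟨hQ, hd⟩
    have hdeg : ∀ i, (Q i i).degree = d i := fun i => by
      rw [degree_eq_natDegree (hQ.diag_monic i).ne_zero, hd]
    have hmem : ∀ (i : Fin m) (j : {j // j ≤ i}),
        Q i j - (if (j : Fin m) = i then X ^ d i else 0) ∈ degreeLT F (d i) := by
      rintro i ⟨j, hj⟩
      rw [mem_degreeLT]
      rcases hj.lt_or_eq with hj | rfl
      · simpa [hj.ne, hdeg] using hQ.degree_lt i j hj
      · rw [← hdeg]
        simp only [if_true]
        refine degree_sub_lt_left ?_ (hQ.diag_monic j).ne_zero ?_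
        · rw [hdeg, degree_X_pow]
        · rw [(hQ.diag_monic j).leadingCoeff, (monic_X_pow _).leadingCoeff]
    refine ⟨fun i j => ⟨_, hmem i j⟩, ?_⟩
    ext1 i j
    by_cases h : j ≤ i
    · simp [hermiteOfLower, h]
    · simp [hermiteOfLower, h, hQ.upper_eq_zero i j (not_le.1 h)]

theorem card_degreeLT [Finite F] (n : ℕ) : Nat.card (degreeLT F n) = Nat.card F ^ n := by
  rw [Nat.card_congr (degreeLTEquiv F n).toEquiv, Nat.card_fun, Nat.card_fin]

/-- Row `i` (counted from 0) has `i + 1` free polynomials of degree below `d i`. -/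
theorem ncard_isHermiteForm_diag [Finite F] (d : Fin m → ℕ) :
    {Q : Matrix (Fin m) (Fin m) F[X] | IsHermiteForm Q ∧ ∀ i, (Q i i).natDegree = d i}.ncard =
      Nat.card F ^ ∑ i : Fin m, ((i : ℕ) + 1) * d i := by
  rw [← range_hermiteOfLower, ← Set.image_univ,
    Set.ncard_image_of_injective _ (hermiteOfLower_injective d), Set.ncard_univ, Nat.card_pi,
    ← Finset.prod_pow_eq_pow_sum]
  refine Finset.prod_congr rfl fun i _ => ?_
  rw [Nat.card_fun, card_degreeLT, ← pow_mul, mul_comm, Nat.card_eq_fintype_card (α := {j // j ≤ i}),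
    Fintype.card_subtype, ← Fin.card_Iic]
  congr 3
  ext j
  simp

theorem ncard_latticesOfDegree [Finite F] (n : ℕ) :
    (latticesOfDegree F m n).ncard =
      ∑ d ∈ Finset.finAntidiagonal m n, Nat.card F ^ ∑ i : Fin m, ((i : ℕ) + 1) * d i := by
  classical
  have h := bijOn_colModule (F := F) (m := m) n
  have hfin := Set.Finite.of_finite_image (h.image_eq.symm ▸ latticesOfDegree_finite n) h.injOn
  rw [← h.image_eq, h.injOn.ncard_image, Set.ncard_eq_toFinset_card _ hfin,
    Finset.card_eq_sum_card_fiberwise (f := fun Q i => (Q i i).natDegree)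
      (t := Finset.finAntidiagonal m n)]
  · refine Finset.sum_congr rfl fun d hd => ?_
    rw [← ncard_isHermiteForm_diag, ← Set.ncard_coe_finset]
    congr 1
    ext Q
    simp only [Finset.coe_filter, Set.Finite.mem_toFinset, Set.mem_ofPred_eq, funext_iff]
    refine ⟨fun hQ => ⟨hQ.1.1, hQ.2⟩, fun hQ => ⟨⟨hQ.1, ?_⟩, hQ.2⟩⟩
    rw [hQ.1.det_natDegree, ← (Finset.mem_finAntidiagonal).1 hd]
    exact Finset.sum_congr rfl fun i _ => hQ.2 i
  · intro Q hQ
    obtain ⟨hQ, hn⟩ := hfin.mem_toFinset.1 hQ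
    exact Finset.mem_finAntidiagonal.2 (hQ.det_natDegree ▸ hn)

/-- Only the last row has the full weight `m + 1`, so a single degree vector gives the dominant
power of `|F|`. -/
theorem weighted_sum_lt {m n : ℕ} {d : Fin (m + 1) → ℕ} (hd : ∑ i, d i = n)
    (hne : d ≠ Pi.single (Fin.last m) n) : ∑ i : Fin (m + 1), ((i : ℕ) + 1) * d i < (m + 1) * n := by
  rw [← hd, Finset.mul_sum]
  refine Finset.sum_lt_sum (fun i _ => Nat.mul_le_mul_right _ (by omega)) ?_
  by_contra! h
  have h0 : ∀ i, i ≠ Fin.last m → d i = 0 := by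
    intro i hi
    by_contra h'
    have := h i (Finset.mem_univ i)
    have := Nat.le_of_mul_le_mul_right this (Nat.pos_of_ne_zero h')
    exact hi (Fin.ext (by rw [Fin.val_last]; omega))
  have hlast : d (Fin.last m) = n := by
    rw [← hd]
    exact (Finset.sum_eq_single_of_mem _ (Finset.mem_univ _) fun i _ hi => h0 i hi).symm
  refine hne (funext fun i => ?_)
  rcases eq_or_ne i (Fin.last m) with rfl | hi
  · simp [hlast]
  · simp [h0 i hi, hi]

/-- The number of lattices of degree `n` is `|F|^{mn}(1 + O(1/|F|))`. -/
theorem ncard_latticesOfDegree_bounds [Finite F] (hm : 1 ≤ m) (n : ℕ) {t : ℝ}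
    (ht : t = 1 / (Nat.card F : ℝ)) :
    1 ≤ ((latticesOfDegree F m n).ncard : ℝ) * t ^ (m * n) ∧
      ((latticesOfDegree F m n).ncard : ℝ) * t ^ (m * n) ≤
        1 + (Finset.finAntidiagonal m n).card * t := by
  obtain ⟨m, rfl⟩ := Nat.exists_eq_add_of_le' hm
  have hq : (1 : ℝ) ≤ Nat.card F := by exact_mod_cast Nat.card_pos
  have hqt : (Nat.card F : ℝ) * t = 1 := by rw [ht]; field_simp
  have ht0 : 0 < t := by rw [ht]; positivity
  have ht1 : t ≤ 1 := by rw [ht]; exact div_le_one_of_le₀ hq (by positivity)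
  have hmem : Pi.single (Fin.last m) n ∈ Finset.finAntidiagonal (m + 1) n := by
    simp
  rw [ncard_latticesOfDegree, Nat.cast_sum, Finset.sum_mul,
    ← Finset.add_sum_erase _ _ hmem]
  have h1 : ((Nat.card F ^ ∑ i : Fin (m + 1), ((i : ℕ) + 1) * (Pi.single (Fin.last m) n : Fin (m + 1) → ℕ) i : ℕ) : ℝ)
      * t ^ ((m + 1) * n) = 1 := by
    rw [Finset.sum_eq_single_of_mem (Fin.last m) (Finset.mem_univ _) fun i _ hi => by simp [hi]]
    simp only [Fin.val_last, Pi.single_eq_same, Nat.cast_pow]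
    rw [← mul_pow, hqt, one_pow]
  rw [h1]
  refine ⟨le_add_of_nonneg_right (Finset.sum_nonneg fun d _ => by positivity),
    add_le_add_right ?_ 1⟩
  calc _ ≤ ∑ d ∈ (Finset.finAntidiagonal (m + 1) n).erase (Pi.single (Fin.last m) n), t := by
        refine Finset.sum_le_sum fun d hd => ?_
        obtain ⟨hne, hd⟩ := Finset.mem_erase.1 hd
        have hlt := weighted_sum_lt (Finset.mem_finAntidiagonal.1 hd) hne
        -- The exponent falls short by `e + 1`, so the term equals `t ^ (e + 1)`, at most `t`.
        obtain ⟨e, he⟩ := Nat.exists_eq_add_of_lt hlt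
        rw [he, add_assoc, pow_add, Nat.cast_pow, ← mul_assoc, ← mul_pow, hqt, one_pow, one_mul]
        exact pow_le_of_le_one ht0.le ht1 (Nat.succ_ne_zero e)
    _ ≤ _ := by
        rw [Finset.sum_const, nsmul_eq_mul]
        gcongr
        exact Finset.erase_subset _ _

/-! ### Normalised counts and the truncated recursion. -/

/-- The number of lattices of degree `n`, divided by `|F|^{mn}` when `t = 1 / |F|`. -/
noncomputable def scaledCount (F : Type*) [Field F] (m : ℕ) (t : ℝ) (n : ℕ) : ℝ :=
  ((latticesOfDegree F m n).ncard : ℝ) * t ^ (m * n)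

/-- The number of pairs of lattices of degrees `n₁`, `n₂` with sum the whole space, divided by
`|F|^{m(n₁+n₂)}` when `t = 1 / |F|`. -/
noncomputable def scaledCoprimeCount (F : Type*) [Field F] (m : ℕ) (t : ℝ) (n₁ n₂ : ℕ) : ℝ :=
  ((latticePairs F m n₁ n₂ ⊤).ncard : ℝ) * (t ^ (m * n₁) * t ^ (m * n₂))

/-- An upper bound for `scaledCount` that does not depend on the field. -/
def countBound (m n : ℕ) : ℝ := 1 + (Finset.finAntidiagonal m n).card

theorem one_le_countBound (m n : ℕ) : 1 ≤ countBound m n := by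
  unfold countBound
  simp

/-- The constant in the error terms of the recursion for coprime pairs. -/
def tailBound (m n₁ n₂ : ℕ) : ℝ :=
  ∑ k ∈ Finset.range (min n₁ n₂ + 1),
    countBound m k * (countBound m (n₁ - k) * countBound m (n₂ - k))

theorem tailBound_nonneg (m n₁ n₂ : ℕ) : 0 ≤ tailBound m n₁ n₂ :=
  Finset.sum_nonneg fun k _ => by
    have h := fun n => zero_le_one.trans (one_le_countBound m n)
    exact mul_nonneg (h _) (mul_nonneg (h _) (h _))

theorem scaledCount_mul_eq_sum [Finite F] (t : ℝ) (n₁ n₂ : ℕ) :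
    scaledCount F m t n₁ * scaledCount F m t n₂ =
      ∑ k ∈ Finset.range (min n₁ n₂ + 1),
        t ^ (m * k) * (scaledCount F m t k * scaledCoprimeCount F m t (n₁ - k) (n₂ - k)) := by
  have h := congrArg (Nat.cast (R := ℝ)) (ncard_mul_ncard_eq_sum (F := F) (m := m) n₁ n₂)
  push_cast at h
  unfold scaledCount scaledCoprimeCount
  rw [mul_mul_mul_comm, h, Finset.sum_mul]
  refine Finset.sum_congr rfl fun k hk => ?_
  rw [Finset.mem_range] at hk
  obtain ⟨a, rfl⟩ := Nat.exists_eq_add_of_le (show k ≤ n₁ by omega)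
  obtain ⟨b, rfl⟩ := Nat.exists_eq_add_of_le (show k ≤ n₂ by omega)
  rw [Nat.add_sub_cancel_left, Nat.add_sub_cancel_left]
  ring

theorem scaledCount_zero [Finite F] (t : ℝ) : scaledCount F m t 0 = 1 := by
  have h : Finset.finAntidiagonal m 0 = {0} := by
    ext d
    simp [Finset.mem_finAntidiagonal, funext_iff]
  rw [scaledCount, ncard_latticesOfDegree, h]
  simp

theorem scaledCoprimeCount_nonneg {t : ℝ} (ht : 0 ≤ t) (n₁ n₂ : ℕ) :
    0 ≤ scaledCoprimeCount F m t n₁ n₂ := by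
  unfold scaledCoprimeCount
  positivity

theorem scaledCoprimeCount_le [Finite F] {t : ℝ} (ht : 0 ≤ t) (n₁ n₂ : ℕ) :
    scaledCoprimeCount F m t n₁ n₂ ≤ scaledCount F m t n₁ * scaledCount F m t n₂ := by
  unfold scaledCoprimeCount scaledCount
  rw [mul_mul_mul_comm]
  gcongr
  exact_mod_cast ncard_latticePairs_le n₁ n₂ ⊤

theorem scaledCount_le_countBound [Finite F] (hm : 1 ≤ m) {t : ℝ} (ht : t = 1 / (Nat.card F : ℝ))
    (ht1 : t ≤ 1) (n : ℕ) : scaledCount F m t n ≤ countBound m n :=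
  (ncard_latticesOfDegree_bounds hm n ht).2.trans
    (add_le_add_right (mul_le_of_le_one_right (Nat.cast_nonneg _) ht1) 1)

/-- Truncating the recursion for coprime pairs after `j` terms. -/
theorem scaledCount_mul_sub_sum_bounds [Finite F] (hm : 1 ≤ m) {t : ℝ}
    (ht : t = 1 / (Nat.card F : ℝ)) (ht0 : 0 ≤ t) (ht1 : t ≤ 1) {n₁ n₂ j : ℕ}
    (hj : j ≤ min n₁ n₂ + 1) :
    |scaledCount F m t n₁ * scaledCount F m t n₂ - ∑ k ∈ Finset.range j,
        t ^ (m * k) * (scaledCount F m t k * scaledCoprimeCount F m t (n₁ - k) (n₂ - k))| ≤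
      tailBound m n₁ n₂ * t ^ (m * j) := by
  have hs0 : ∀ n, 0 ≤ scaledCount F m t n := fun n =>
    zero_le_one.trans (ncard_latticesOfDegree_bounds hm n ht).1
  have hs := scaledCount_le_countBound (F := F) hm ht ht1
  have hc0 : ∀ n, 0 ≤ countBound m n := fun n => zero_le_one.trans (one_le_countBound m n)
  have hp0 := scaledCoprimeCount_nonneg (F := F) (m := m) ht0
  rw [scaledCount_mul_eq_sum, ← Finset.sum_range_add_sum_Ico _ hj, add_sub_cancel_left,
    abs_of_nonneg (Finset.sum_nonneg fun k _ =>
      mul_nonneg (pow_nonneg ht0 _) (mul_nonneg (hs0 _) (hp0 _ _))), tailBound, Finset.sum_mul]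
  refine (Finset.sum_le_sum fun k hk => ?_).trans
    (Finset.sum_le_sum_of_subset_of_nonneg (s := Finset.Ico j (min n₁ n₂ + 1)) ?_
      fun k _ _ => ?_)
  · rw [mul_comm]
    refine mul_le_mul ?_ ?_ (pow_nonneg ht0 _) (mul_nonneg (hc0 _) (mul_nonneg (hc0 _) (hc0 _)))
    · refine mul_le_mul (hs k) ?_ (hp0 _ _) (hc0 k)
      exact (scaledCoprimeCount_le ht0 _ _).trans (mul_le_mul (hs _) (hs _) (hs0 _) (hc0 _))
    · exact pow_le_pow_of_le_one ht0 ht1 (Nat.mul_le_mul_left m (Finset.mem_Ico.1 hk).1)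
  · intro k hk
    exact Finset.mem_range.2 (Finset.mem_Ico.1 hk).2
  · exact mul_nonneg (mul_nonneg (hc0 _) (mul_nonneg (hc0 _) (hc0 _))) (pow_nonneg ht0 _)

theorem mul_bounds_of_bounds {x y a b t : ℝ} (ht0 : 0 ≤ t) (ht1 : t ≤ 1) (ha : 0 ≤ a) (hb : 0 ≤ b)
    (hx : 1 ≤ x ∧ x ≤ 1 + a * t) (hy : 1 ≤ y ∧ y ≤ 1 + b * t) :
    1 ≤ x * y ∧ x * y ≤ 1 + (a + b + a * b) * t := by
  refine ⟨one_le_mul_of_one_le_of_one_le hx.1 hy.1, ?_⟩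
  calc x * y ≤ (1 + a * t) * (1 + b * t) :=
        mul_le_mul hx.2 hy.2 (zero_le_one.trans hy.1) (by positivity)
    _ = 1 + (a + b) * t + a * b * t * t := by ring
    _ ≤ 1 + (a + b) * t + a * b * t :=
        add_le_add_right (mul_le_of_le_one_right (by positivity) ht1) _
    _ = _ := by ring

theorem probLeftCoprime_eq_scaled {t : ℝ} (ht : t ≠ 0) (n₁ n₂ : ℕ) :
    probLeftCoprime F m ![n₁, n₂] =
      scaledCoprimeCount F m t n₁ n₂ / (scaledCount F m t n₁ * scaledCount F m t n₂) := by
  rw [probLeftCoprime, ncard_leftCoprime, ncard_hermiteTuples, scaledCoprimeCount, scaledCount,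
    scaledCount, mul_mul_mul_comm, Nat.cast_mul, mul_div_mul_right]
  positivity

end PolyMat

/-! ### The asymptotic estimate. -/

open PolyMat in
theorem mainTheorem7 (m n₁ n₂ : ℕ) (hm : 1 ≤ m) (hn₁ : 1 ≤ n₁) (hn₂ : 1 ≤ n₂) :
    ∃ C : ℝ, ∀ (F : Type*) [Field F] [Finite F] (t : ℝ), t = 1 / (Nat.card F : ℝ) →
      |PolyMat.probLeftCoprime F m ![n₁, n₂] - (1 - t ^ m)| ≤ C * t ^ (m + 1) := by
  let c : ℕ → ℝ := fun n => (Finset.finAntidiagonal m n).card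
  have hc : ∀ n, 0 ≤ c n := fun n => Nat.cast_nonneg _
  let X : ℝ := c n₁ + c n₂ + c n₁ * c n₂
  let Y : ℝ := c (n₁ - 1) + c (n₂ - 1) + c (n₁ - 1) * c (n₂ - 1)
  let Z : ℝ := c 1 + Y + c 1 * Y
  have hY : 0 ≤ Y := add_nonneg (add_nonneg (hc _) (hc _)) (mul_nonneg (hc _) (hc _))
  refine ⟨tailBound m n₁ n₂ + (X + Z + countBound m 1 * tailBound m (n₁ - 1) (n₂ - 1)), ?_⟩
  intro F _ _ t ht
  have hq : (1 : ℝ) ≤ Nat.card F := by exact_mod_cast Nat.card_pos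
  have ht0 : 0 < t := by rw [ht]; positivity
  have ht1 : t ≤ 1 := by rw [ht]; exact div_le_one_of_le₀ hq (by positivity)
  have hA : ∀ n, 1 ≤ scaledCount F m t n ∧ scaledCount F m t n ≤ 1 + c n * t := fun n =>
    ncard_latticesOfDegree_bounds hm n ht
  have hx := mul_bounds_of_bounds ht0.le ht1 (hc _) (hc _) (hA n₁) (hA n₂)
  have hy := mul_bounds_of_bounds ht0.le ht1 (hc _) (hc _) (hA (n₁ - 1)) (hA (n₂ - 1))
  have hz := mul_bounds_of_bounds ht0.le ht1 (hc _) hY (hA 1) hy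
  -- One term suffices for the smaller pair, since `p'` enters only multiplied by `t ^ m`; the
  -- original pair needs two.
  have h1 := scaledCount_mul_sub_sum_bounds hm ht ht0.le ht1
    (show 1 ≤ min (n₁ - 1) (n₂ - 1) + 1 by omega)
  have h2 := scaledCount_mul_sub_sum_bounds hm ht ht0.le ht1
    (show 2 ≤ min n₁ n₂ + 1 by omega)
  have hA1 := scaledCount_le_countBound hm ht ht1 1
  have hA1' := (hA 1).1
  simp only [Finset.sum_range_succ, Finset.sum_range_zero, zero_add, mul_zero, pow_zero, one_mul,
    mul_one, scaledCount_zero, Nat.sub_zero] at h1 h2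
  rw [probLeftCoprime_eq_scaled ht0.ne']
  set x := scaledCount F m t n₁ * scaledCount F m t n₂
  set y := scaledCount F m t (n₁ - 1) * scaledCount F m t (n₂ - 1)
  set p := scaledCoprimeCount F m t n₁ n₂
  set p' := scaledCoprimeCount F m t (n₁ - 1) (n₂ - 1)
  set a := scaledCount F m t 1
  have hT := tailBound_nonneg m n₁ n₂
  have hT' := tailBound_nonneg m (n₁ - 1) (n₂ - 1)
  have hb := one_le_countBound m 1
  have hd : |x - a * p'| ≤ (X + Z + countBound m 1 * tailBound m (n₁ - 1) (n₂ - 1)) * t := by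
    have e : x - a * p' = (x - 1) - (a * y - 1) + a * (y - p') := by ring
    have e1 : |x - 1| ≤ X * t := by
      rw [abs_of_nonneg (sub_nonneg.2 hx.1)]
      linarith [hx.2]
    have e2 : |a * y - 1| ≤ Z * t := by
      rw [abs_of_nonneg (sub_nonneg.2 hz.1)]
      linarith [hz.2]
    have e3 : |a * (y - p')| ≤ countBound m 1 * (tailBound m (n₁ - 1) (n₂ - 1) * t) := by
      rw [abs_mul, abs_of_nonneg (zero_le_one.trans hA1')]
      refine mul_le_mul hA1 (h1.trans ?_) (abs_nonneg _) (zero_le_one.trans hb)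
      gcongr
      exact pow_le_of_le_one ht0.le ht1 (by omega)
    rw [e]
    linarith [abs_add_le (x - 1 - (a * y - 1)) (a * (y - p')), abs_sub (x - 1) (a * y - 1)]
  have hxpos : 0 < x := zero_lt_one.trans_le hx.1
  -- The first difference is `O(t)` because `x` and `a * p'` are both `1 + O(t)`; the second is the
  -- recursion's tail. Dividing by `x ≥ 1` costs nothing.
  have e : p / x - (1 - t ^ m) = (t ^ m * (x - a * p') - (x - (p + t ^ m * (a * p')))) / x := by
    field_simp
    ring
  rw [e, abs_div, abs_of_pos hxpos]
  refine (div_le_self (abs_nonneg _) hx.1).trans ((abs_sub _ _).trans ?_)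
  rw [abs_mul, abs_of_nonneg (pow_nonneg ht0.le m), add_comm, add_mul]
  refine add_le_add (h2.trans ?_) ?_
  -- Here `m ≥ 1` gives `2m ≥ m + 1`.
  · exact mul_le_mul_of_nonneg_left (pow_le_pow_of_le_one ht0.le ht1 (by omega)) hT
  · calc _ ≤ t ^ m * ((X + Z + countBound m 1 * tailBound m (n₁ - 1) (n₂ - 1)) * t) := by gcongr
      _ = _ := by ring
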